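/- Let $\mathcal{F}_\infty := C^\ast(x_1,x_2,\ldots \mid \|x_i\|\le 1)$ be the universal $C^\ast$-algebra generated by countably many contractions. For $C^\ast$-algebras $A$ and $B$, let $A\ast B$ denote their (full, non-unital) free product. Morphisms between $C^\ast$-algebras are $\ast$-homomorphisms, not necessarily unital, and ideals are closed and two-sided. A $C^\ast$-algebra $A$ is called projective if for every $C^\ast$-algebra $C$, every ideal $J\lhd C$ and every morphism $\sigma\colon A\to C/J$ there is a morphism $\psi\colon A\to C$ with $\pi\circ\psi=\sigma$, where $\pi\colon C\to C/J$ is the quotient morphism. It is called semiprojective if for every $C^\ast$-algebra $C$, every increasing sequence of ideals $J_1\subset J_2\subset\cdots$ of $C$ and every morphism $\sigma\colon A\to C/\overline{\bigcup_k J_k}$ there are an index $k$ and a morphism $\psi\colon A\to C/J_k$ with $\pi_k\circ\psi=\sigma$, where $\pi_k\colon C/J_k\to C/\overline{\bigcup_k J_k}$ is the quotient morphism. Let $(A_k,\gamma_k)$ be an inductive system of separable $C^\ast$-algebras, i.e. a sequence $A_1,A_2,\ldots$ of separable $C^\ast$-algebras with morphisms $\gamma_k\colon A_k\to A_{k+1}$,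 and put $B_k:=A_k\ast\mathcal{F}_\infty$. Then there exist surjective morphisms $\delta_k\colon B_k\to B_{k+1}$ such that $$\varinjlim (A_k,\gamma_k)\;\cong\;\varinjlim (B_k,\delta_k).$$ Moreover, for each $k$: if $A_k$ is projective, then so is $B_k$; and if $A_k$ is semiprojective, then so is $B_k$. -/

import Mathlib

open scoped NNReal

universe u v

noncomputable section

/-! ### The free complex `*`-algebra on a type of generators -/

/-- The involution on words in the letters `x` (`Sum.inl x`) and `x*` (`Sum.inr x`): it reverses
a word and exchanges the letters `x` and `x*`. -/
def starWord {X : Type u} : FreeSemigroup (X ⊕ X) →ₙ* (FreeSemigroup (X ⊕ X))ᵐᵒᵖ :=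
  FreeSemigroup.lift fun l => MulOpposite.op (FreeSemigroup.of l.swap)

/-- The free (non-unital) complex `*`-algebra on `X`: non-commutative polynomials without constant
term in the letters `x` and `x*`. -/
def FreeStarAlg (X : Type u) : Type u := MonoidAlgebra ℂ (FreeSemigroup (X ⊕ X))

namespace FreeStarAlg

variable {X : Type u}

instance : NonUnitalRing (FreeStarAlg X) :=
  inferInstanceAs (NonUnitalRing (MonoidAlgebra ℂ (FreeSemigroup (X ⊕ X))))

instance : Module ℂ (FreeStarAlg X) :=
  inferInstanceAs (Module ℂ (MonoidAlgebra ℂ (FreeSemigroup (X ⊕ X))))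

instance : IsScalarTower ℂ (FreeStarAlg X) (FreeStarAlg X) :=
  inferInstanceAs (IsScalarTower ℂ (MonoidAlgebra ℂ (FreeSemigroup (X ⊕ X)))
    (MonoidAlgebra ℂ (FreeSemigroup (X ⊕ X))))

instance : SMulCommClass ℂ (FreeStarAlg X) (FreeStarAlg X) :=
  inferInstanceAs (SMulCommClass ℂ (MonoidAlgebra ℂ (FreeSemigroup (X ⊕ X)))
    (MonoidAlgebra ℂ (FreeSemigroup (X ⊕ X))))

/-- The scalar multiple `c w` of a word `w`. -/
def single (w : FreeSemigroup (X ⊕ X)) (c : ℂ) : FreeStarAlg X := MonoidAlgebra.single w c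

/-- The generator `x`. -/
def of (x : X) : FreeStarAlg X := single (FreeSemigroup.of (Sum.inl x)) 1

theorem single_mul (w w' : FreeSemigroup (X ⊕ X)) (c c' : ℂ) :
    single w c * single w' c' = single (w * w') (c * c') :=
  MonoidAlgebra.single_mul_single ..

theorem smul_single (w : FreeSemigroup (X ⊕ X)) (a c : ℂ) :
    a • single w c = single w (a * c) :=
  MonoidAlgebra.smul_single ..

theorem addHom_ext {N : Type v} [AddZeroClass N] {f g : FreeStarAlg X →+ N}
    (h : ∀ w c, f (single w c) = g (single w c)) : f = g :=
  MonoidAlgebra.addMonoidHom_ext h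

theorem starWord_starWord (w : FreeSemigroup (X ⊕ X)) :
    (starWord (starWord w).unop).unop = w := by
  induction w with
  | ih1 l => simp [starWord]
  | ih2 l w h1 h2 => simp only [map_mul, MulOpposite.unop_mul, h1, h2]

/-- The involution as an additive map: `∑ c w ↦ ∑ c̄ w*`. -/
def starAdd : FreeStarAlg X →+ FreeStarAlg X :=
  (Finsupp.liftAddHom fun w : FreeSemigroup (X ⊕ X) =>
    (MonoidAlgebra.singleAddHom (R := ℂ) (starWord w).unop).comp
      (starAddEquiv (R := ℂ)).toAddMonoidHom).comp
    (MonoidAlgebra.coeffAddEquiv (R := ℂ) (M := FreeSemigroup (X ⊕ X))).toAddMonoidHom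

theorem starAdd_single (w : FreeSemigroup (X ⊕ X)) (c : ℂ) :
    starAdd (single w c) = single (starWord w).unop (star c) :=
  Finsupp.liftAddHom_apply_single _ w c

theorem starAdd_starAdd (a : FreeStarAlg X) : starAdd (starAdd a) = a := by
  have : (starAdd.comp starAdd : FreeStarAlg X →+ FreeStarAlg X) = AddMonoidHom.id _ :=
    addHom_ext fun w c => by simp [starAdd_single, starWord_starWord]
  exact DFunLike.congr_fun this a

theorem starAdd_mul (a b : FreeStarAlg X) : starAdd (a * b) = starAdd b * starAdd a := by
  have : (AddMonoidHom.mul : FreeStarAlg X →+ _ →+ _).compr₂ starAdd =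
      ((AddMonoidHom.mul : FreeStarAlg X →+ _ →+ _).flip.comp starAdd).compl₂ starAdd :=
    addHom_ext fun w c => addHom_ext fun w' c' => by
      simp [starAdd_single, single_mul, mul_comm]
  exact DFunLike.congr_fun (DFunLike.congr_fun this a) b

instance : StarRing (FreeStarAlg X) where
  star := starAdd
  star_involutive := starAdd_starAdd
  star_mul := starAdd_mul
  star_add := map_add starAdd

theorem star_single (w : FreeSemigroup (X ⊕ X)) (c : ℂ) :
    star (single w c) = single (starWord w).unop (star c) := starAdd_single w c

instance : StarModule ℂ (FreeStarAlg X) where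
  star_smul r a := by
    have : (starAdd.comp (DistribSMul.toAddMonoidHom (FreeStarAlg X) r)) =
        (DistribSMul.toAddMonoidHom (FreeStarAlg X) (star r)).comp starAdd :=
      addHom_ext fun w c => by simp [starAdd_single, smul_single]
    exact DFunLike.congr_fun this a

end FreeStarAlg

/-! ### Universal C*-algebras given by generators and relations -/

/-- Generators `X`, a norm bound for each generator, and a set of `*`-polynomials in the generators
that are required to vanish. -/
structure CStarPresentation (X : Type u) where
  bound : X → ℝ≥0
  rel : Set (FreeStarAlg X)

/-- A seminorm `p` on the free `*`-algebra is a C*-seminorm compatible with the presentation. -/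
structure CStarPresentation.Admissible {X : Type u} (P : CStarPresentation X)
    (p : Seminorm ℂ (FreeStarAlg X)) : Prop where
  mul_le : ∀ a b, p (a * b) ≤ p a * p b
  star_mul_self : ∀ a, p (star a * a) = p a * p a
  le_bound : ∀ x, p (FreeStarAlg.of x) ≤ P.bound x
  rel_eq_zero : ∀ r ∈ P.rel, p r = 0

namespace CStarPresentation

variable {X : Type u} (P : CStarPresentation X)

/-- The free `*`-algebra, to be equipped with the largest admissible C*-seminorm. -/
def Pre (_P : CStarPresentation X) : Type u := FreeStarAlg X

/-- The identity map onto the free `*`-algebra with its new seminorm. -/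
def toPre (a : FreeStarAlg X) : P.Pre := a

instance : NonUnitalRing P.Pre := inferInstanceAs (NonUnitalRing (FreeStarAlg X))
instance : Module ℂ P.Pre := inferInstanceAs (Module ℂ (FreeStarAlg X))
instance : IsScalarTower ℂ P.Pre P.Pre :=
  inferInstanceAs (IsScalarTower ℂ (FreeStarAlg X) (FreeStarAlg X))
instance : SMulCommClass ℂ P.Pre P.Pre :=
  inferInstanceAs (SMulCommClass ℂ (FreeStarAlg X) (FreeStarAlg X))
instance : StarRing P.Pre := inferInstanceAs (StarRing (FreeStarAlg X))
instance : StarModule ℂ P.Pre := inferInstanceAs (StarModule ℂ (FreeStarAlg X))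

/-- The largest admissible C*-seminorm: the supremum of all of them. -/
def maxNorm (a : FreeStarAlg X) : ℝ := ⨆ p : {p : Seminorm ℂ (FreeStarAlg X) // P.Admissible p}, p.1 a

variable {P}

theorem Admissible.star_eq {p : Seminorm ℂ (FreeStarAlg X)} (hp : P.Admissible p)
    (a : FreeStarAlg X) : p (star a) = p a := by
  have key : ∀ b, p b ≤ p (star b) := fun b => by
    by_contra! h
    have h0 : 0 < p b := (apply_nonneg p _).trans_lt h
    have := hp.mul_le (star b) b
    rw [hp.star_mul_self] at this
    nlinarith
  exact le_antisymm (by simpa using key (star a)) (key a)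

variable (P)

theorem admissible_zero : P.Admissible 0 := by
  constructor <;> intros <;> simp

instance : Nonempty {p : Seminorm ℂ (FreeStarAlg X) // P.Admissible p} := ⟨⟨0, P.admissible_zero⟩⟩

theorem exists_bound_word (w : FreeSemigroup (X ⊕ X)) :
    ∃ M : ℝ, ∀ p, P.Admissible p → p (FreeStarAlg.single w 1) ≤ M := by
  induction w with
  | ih1 l =>
    rcases l with x | x
    · exact ⟨P.bound x, fun p hp => hp.le_bound x⟩
    · refine ⟨P.bound x, fun p hp => ?_⟩
      have : FreeStarAlg.single (FreeSemigroup.of (Sum.inr x)) 1 = star (FreeStarAlg.of x) := by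
        simp [FreeStarAlg.of, FreeStarAlg.star_single, starWord]
      rw [this, hp.star_eq]
      exact hp.le_bound x
  | ih2 l w h1 h2 =>
    obtain ⟨M, hM⟩ := h1
    obtain ⟨N, hN⟩ := h2
    refine ⟨M * N, fun p hp => ?_⟩
    have := hp.mul_le (FreeStarAlg.single (FreeSemigroup.of l) 1) (FreeStarAlg.single w 1)
    rw [FreeStarAlg.single_mul, one_mul] at this
    exact this.trans (mul_le_mul (hM p hp) (hN p hp) (apply_nonneg p _)
      ((apply_nonneg p _).trans (hM p hp)))

theorem exists_bound (a : FreeStarAlg X) : ∃ M : ℝ, ∀ p, P.Admissible p → p a ≤ M := by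
  let S : AddSubmonoid (FreeStarAlg X) :=
    { carrier := {a | ∃ M : ℝ, ∀ p, P.Admissible p → p a ≤ M}
      zero_mem' := ⟨0, fun p _ => by simp⟩
      add_mem' := by
        rintro a b ⟨M, hM⟩ ⟨N, hN⟩
        exact ⟨M + N, fun p hp => (map_add_le_add p a b).trans (add_le_add (hM p hp) (hN p hp))⟩ }
  have hS : ∀ w c, FreeStarAlg.single w c ∈ S := fun w c => by
    obtain ⟨M, hM⟩ := P.exists_bound_word w
    refine ⟨‖c‖ * M, fun p hp => ?_⟩
    have : FreeStarAlg.single w c = c • FreeStarAlg.single w 1 := by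
      rw [FreeStarAlg.smul_single, mul_one]
    rw [this, map_smul_eq_mul]
    exact mul_le_mul_of_nonneg_left (hM p hp) (norm_nonneg c)
  suffices a ∈ S from this
  have : ∀ f : FreeSemigroup (X ⊕ X) →₀ ℂ, (MonoidAlgebra.ofCoeff f : FreeStarAlg X) ∈ S := by
    intro f
    induction f using Finsupp.induction_linear with
    | zero => exact S.zero_mem
    | add f g hf hg => exact S.add_mem hf hg
    | single w c => exact hS w c
  exact this (MonoidAlgebra.coeff a)

theorem bddAbove (a : FreeStarAlg X) : BddAbove (Set.range
    fun p : {p : Seminorm ℂ (FreeStarAlg X) // P.Admissible p} => p.1 a) := by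
  obtain ⟨M, hM⟩ := P.exists_bound a
  exact ⟨M, by rintro _ ⟨p, rfl⟩; exact hM p.1 p.2⟩

variable {P} in
theorem Admissible.le_maxNorm {p : Seminorm ℂ (FreeStarAlg X)} (hp : P.Admissible p)
    (a : FreeStarAlg X) : p a ≤ P.maxNorm a :=
  le_ciSup (P.bddAbove a) ⟨p, hp⟩

theorem maxNorm_le {a : FreeStarAlg X} {M : ℝ} (h : ∀ p, P.Admissible p → p a ≤ M) :
    P.maxNorm a ≤ M :=
  ciSup_le fun p => h p.1 p.2

theorem maxNorm_nonneg (a : FreeStarAlg X) : 0 ≤ P.maxNorm a :=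
  P.admissible_zero.le_maxNorm a

/-- The largest admissible C*-seminorm as a seminorm. -/
def maxSeminorm : Seminorm ℂ (FreeStarAlg X) :=
  Seminorm.ofSMulLE P.maxNorm
    (le_antisymm (P.maxNorm_le fun p _ => by simp) (P.maxNorm_nonneg 0))
    (fun a b => P.maxNorm_le fun p hp => (map_add_le_add p a b).trans
      (add_le_add (hp.le_maxNorm a) (hp.le_maxNorm b)))
    (fun c a => P.maxNorm_le fun p hp => by
      rw [map_smul_eq_mul]
      exact mul_le_mul_of_nonneg_left (hp.le_maxNorm a) (norm_nonneg c))

theorem maxSeminorm_apply (a : FreeStarAlg X) : P.maxSeminorm a = P.maxNorm a := rfl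

theorem admissible_maxSeminorm : P.Admissible P.maxSeminorm where
  mul_le a b := P.maxNorm_le fun p hp => (hp.mul_le a b).trans
    (mul_le_mul (hp.le_maxNorm a) (hp.le_maxNorm b) (apply_nonneg p b) (P.maxNorm_nonneg a))
  star_mul_self a := by
    simp only [maxSeminorm_apply]
    refine le_antisymm (P.maxNorm_le fun p hp => ?_) ?_
    · rw [hp.star_mul_self]
      exact mul_self_le_mul_self (apply_nonneg p a) (hp.le_maxNorm a)
    · have : P.maxNorm a ≤ √(P.maxNorm (star a * a)) := P.maxNorm_le fun p hp =>
        Real.le_sqrt_of_sq_le (by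
          rw [sq, ← hp.star_mul_self]; exact hp.le_maxNorm _)
      calc P.maxNorm a * P.maxNorm a
          ≤ √(P.maxNorm (star a * a)) * √(P.maxNorm (star a * a)) :=
            mul_self_le_mul_self (P.maxNorm_nonneg a) this
        _ = _ := Real.mul_self_sqrt (P.maxNorm_nonneg _)
  le_bound x := P.maxNorm_le fun p hp => hp.le_bound x
  rel_eq_zero r hr := le_antisymm (P.maxNorm_le fun p hp => (hp.rel_eq_zero r hr).le)
    (P.maxNorm_nonneg r)

instance : Norm P.Pre := ⟨P.maxSeminorm⟩

instance : SeminormedAddCommGroup P.Pre :=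
  SeminormedAddCommGroup.ofCore (𝕜 := ℂ)
    { norm_nonneg := apply_nonneg P.maxSeminorm
      norm_smul := map_smul_eq_mul P.maxSeminorm
      norm_triangle := map_add_le_add P.maxSeminorm }

instance : NonUnitalSeminormedRing P.Pre where
  __ := (inferInstance : SeminormedAddCommGroup P.Pre)
  __ := (inferInstance : NonUnitalRing P.Pre)
  norm_mul_le := P.admissible_maxSeminorm.mul_le

instance : NormedSpace ℂ P.Pre where
  norm_smul_le c a := (map_smul_eq_mul P.maxSeminorm c a).le

theorem norm_star_pre (a : P.Pre) : ‖star a‖ = ‖a‖ := P.admissible_maxSeminorm.star_eq a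

theorem norm_star_mul_self_pre (a : P.Pre) : ‖star a * a‖ = ‖a‖ * ‖a‖ :=
  P.admissible_maxSeminorm.star_mul_self a

end CStarPresentation

open UniformSpace

/-- The universal C*-algebra of a presentation: the (Hausdorff) completion of the free `*`-algebra
with respect to the largest admissible C*-seminorm. -/
def UniversalCStar {X : Type u} (P : CStarPresentation X) : Type u := Completion P.Pre

namespace UniversalCStar

variable {X : Type u} (P : CStarPresentation X)

instance : NormedAddCommGroup (UniversalCStar P) :=
  inferInstanceAs (NormedAddCommGroup (Completion P.Pre))

instance : NormedSpace ℂ (UniversalCStar P) :=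
  inferInstanceAs (NormedSpace ℂ (Completion P.Pre))

instance : CompleteSpace (UniversalCStar P) :=
  inferInstanceAs (CompleteSpace (Completion P.Pre))

variable {P}

/-- The canonical map from the free `*`-algebra. -/
def mk (a : P.Pre) : UniversalCStar P := (a : Completion P.Pre)

/-- The image of the generator `x`. -/
def of (x : X) : UniversalCStar P := mk (P.toPre (FreeStarAlg.of x))

theorem isDenseInducing_mk : IsDenseInducing (mk : P.Pre → UniversalCStar P) :=
  Completion.isDenseInducing_coe

theorem continuous_mk : Continuous (mk : P.Pre → UniversalCStar P) := Completion.continuous_coe _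

theorem norm_mk (a : P.Pre) : ‖mk a‖ = ‖a‖ := Completion.norm_coe a

theorem mk_add (a b : P.Pre) : mk (a + b) = mk a + mk b := Completion.coe_add a b

theorem mk_smul (c : ℂ) (a : P.Pre) : mk (c • a) = c • mk a := Completion.coe_smul c a

/-- `mk` as an additive map. -/
def mkAdd : P.Pre →+ UniversalCStar P := AddMonoidHom.mk' mk mk_add

instance : Mul (UniversalCStar P) :=
  ⟨Function.curry ((isDenseInducing_mk.prodMap isDenseInducing_mk).extend
    (mk ∘ Function.uncurry (· * ·)))⟩

instance : Star (UniversalCStar P) := ⟨isDenseInducing_mk.extend (mk ∘ star)⟩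

theorem mk_mul (a b : P.Pre) : mk (a * b) = mk a * mk b :=
  ((isDenseInducing_mk.prodMap isDenseInducing_mk).extend_eq
    (continuous_mk.comp continuous_mul) (a, b)).symm

theorem continuous_star_pre : Continuous (star : P.Pre → P.Pre) :=
  (AddMonoidHomClass.isometry_of_norm (starAddEquiv (R := P.Pre)) P.norm_star_pre).continuous

theorem mk_star (a : P.Pre) : mk (star a) = star (mk a) :=
  (isDenseInducing_mk.extend_eq (continuous_mk.comp continuous_star_pre) a).symm

instance : ContinuousMul (UniversalCStar P) where
  continuous_mul := by
    let m := (AddMonoidHom.mul : P.Pre →+ P.Pre →+ P.Pre).compr₂ mkAdd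
    have hm : Continuous fun p : P.Pre × P.Pre => m p.1 p.2 := continuous_mk.comp continuous_mul
    have di : IsDenseInducing (mkAdd : P.Pre → UniversalCStar P) := isDenseInducing_mk
    exact (di.extend_Z_bilin di hm :)

instance : ContinuousStar (UniversalCStar P) where
  continuous_star := by
    have : UniformContinuous (mk ∘ star : P.Pre → UniversalCStar P) :=
      (Completion.uniformContinuous_coe P.Pre).comp
        (AddMonoidHomClass.isometry_of_norm (starAddEquiv (R := P.Pre))
          P.norm_star_pre).uniformContinuous
    exact (uniformContinuous_uniformly_extend (Completion.isUniformInducing_coe P.Pre)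
      isDenseInducing_mk.dense this).continuous

@[elab_as_elim]
theorem induction₁ {p : UniversalCStar P → Prop} (a : UniversalCStar P)
    (hp : IsClosed {a | p a}) (ih : ∀ a : P.Pre, p (mk a)) : p a :=
  Completion.induction_on a hp ih

@[elab_as_elim]
theorem induction₂ {p : UniversalCStar P → UniversalCStar P → Prop} (a b : UniversalCStar P)
    (hp : IsClosed {x : UniversalCStar P × UniversalCStar P | p x.1 x.2})
    (ih : ∀ a b : P.Pre, p (mk a) (mk b)) : p a b :=
  Completion.induction_on₂ a b hp ih

@[elab_as_elim]
theorem induction₃ {p : UniversalCStar P → UniversalCStar P → UniversalCStar P → Prop}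
    (a b c : UniversalCStar P)
    (hp : IsClosed {x : UniversalCStar P × UniversalCStar P × UniversalCStar P |
      p x.1 x.2.1 x.2.2})
    (ih : ∀ a b c : P.Pre, p (mk a) (mk b) (mk c)) : p a b c :=
  Completion.induction_on₃ a b c hp ih

theorem mk_zero : mk (0 : P.Pre) = 0 := map_zero mkAdd

instance : NonUnitalRing (UniversalCStar P) where
  __ := (inferInstance : AddCommGroup (UniversalCStar P))
  __ := (inferInstance : Mul (UniversalCStar P))
  zero_mul a := induction₁ a (isClosed_eq (by fun_prop) continuous_const)
    fun a => by rw [← mk_zero, ← mk_mul, zero_mul]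
  mul_zero a := induction₁ a (isClosed_eq (by fun_prop) continuous_const)
    fun a => by rw [← mk_zero, ← mk_mul, mul_zero]
  mul_assoc a b c := induction₃ a b c (isClosed_eq (by fun_prop) (by fun_prop))
    fun a b c => by simp only [← mk_mul, mul_assoc]
  left_distrib a b c := induction₃ a b c (isClosed_eq (by fun_prop) (by fun_prop))
    fun a b c => by simp only [← mk_mul, ← mk_add, mul_add]
  right_distrib a b c := induction₃ a b c (isClosed_eq (by fun_prop) (by fun_prop))
    fun a b c => by simp only [← mk_mul, ← mk_add, add_mul]

instance : NonUnitalNormedRing (UniversalCStar P) where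
  __ := (inferInstance : NormedAddCommGroup (UniversalCStar P))
  __ := (inferInstance : NonUnitalRing (UniversalCStar P))
  norm_mul_le a b := induction₂ a b (isClosed_le (by fun_prop) (by fun_prop))
    fun a b => by simpa only [← mk_mul, norm_mk] using norm_mul_le a b

instance : StarRing (UniversalCStar P) where
  star_involutive a := induction₁ a (isClosed_eq (by fun_prop) continuous_id)
    fun a => by rw [← mk_star, ← mk_star, star_star]
  star_mul a b := induction₂ a b (isClosed_eq (by fun_prop) (by fun_prop))
    fun a b => by simp only [← mk_mul, ← mk_star, star_mul]
  star_add a b := induction₂ a b (isClosed_eq (by fun_prop) (by fun_prop))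
    fun a b => by simp only [← mk_add, ← mk_star, star_add]

instance : CStarRing (UniversalCStar P) where
  norm_mul_self_le a := induction₁ a (isClosed_le (by fun_prop) (by fun_prop))
    fun a => by
      rw [← mk_star, ← mk_mul, norm_mk, norm_mk, P.norm_star_mul_self_pre]

instance : IsScalarTower ℂ (UniversalCStar P) (UniversalCStar P) where
  smul_assoc c a b := induction₂ a b
    (isClosed_eq ((continuous_fst.const_smul c).mul continuous_snd)
      ((continuous_fst.mul continuous_snd).const_smul c))
    fun a b => by simp only [smul_eq_mul, ← mk_smul, ← mk_mul, smul_mul_assoc]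

instance : SMulCommClass ℂ (UniversalCStar P) (UniversalCStar P) where
  smul_comm c a b := induction₂ a b
    (isClosed_eq ((continuous_fst.mul continuous_snd).const_smul c)
      (continuous_fst.mul (continuous_snd.const_smul c)))
    fun a b => by simp only [smul_eq_mul, ← mk_smul, ← mk_mul, mul_smul_comm]

instance : StarModule ℂ (UniversalCStar P) where
  star_smul c a := induction₁ a
    (isClosed_eq (continuous_id.const_smul c).star (continuous_id.star.const_smul (star c)))
    fun a => by simp only [← mk_smul, ← mk_star, star_smul]

instance : NonUnitalCStarAlgebra (UniversalCStar P) where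

end UniversalCStar

/-! ### The free C*-algebra on countably many contractions, free products, inductive limits -/

/-- Countably many generators `x₀, x₁, …`, subject to `‖xᵢ‖ ≤ 1`. -/
def FInftyPres : CStarPresentation ℕ where
  bound _ := 1
  rel := ∅

/-- The universal C*-algebra `C*(x₀, x₁, … | ‖xᵢ‖ ≤ 1)` on countably many contractions. -/
abbrev FInfty : Type := UniversalCStar FInftyPres

/-- The relations which say that the generators `j a`, `a ∈ A`, depend on `a` through a
`*`-homomorphism. -/
inductive StarHomRel {X : Type u} {A : Type v} [NonUnitalCStarAlgebra A] (j : A → X) :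
    FreeStarAlg X → Prop
  | add (a b : A) : StarHomRel j
      (FreeStarAlg.of (j (a + b)) - (FreeStarAlg.of (j a) + FreeStarAlg.of (j b)))
  | smul (c : ℂ) (a : A) : StarHomRel j (FreeStarAlg.of (j (c • a)) - c • FreeStarAlg.of (j a))
  | mul (a b : A) : StarHomRel j (FreeStarAlg.of (j (a * b)) - FreeStarAlg.of (j a) * FreeStarAlg.of (j b))
  | star (a : A) : StarHomRel j (FreeStarAlg.of (j (star a)) - star (FreeStarAlg.of (j a)))

/-- Generators `A ⊔ B`, subject to the relations that `A` and `B` are mapped by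
`*`-homomorphisms. The norm bound on the generators is automatic, since `*`-homomorphisms between
C*-algebras are contractive. -/
def freeProductPres (A : Type u) (B : Type v) [NonUnitalCStarAlgebra A]
    [NonUnitalCStarAlgebra B] : CStarPresentation (A ⊕ B) where
  bound := Sum.elim (fun a => ‖a‖₊) (fun b => ‖b‖₊)
  rel := {r | StarHomRel Sum.inl r ∨ StarHomRel Sum.inr r}

/-- The (full, non-unital) free product of two C*-algebras: the universal C*-algebra generated by
`*`-homomorphic images of `A` and `B`. -/
abbrev FreeProduct (A : Type u) (B : Type v) [NonUnitalCStarAlgebra A] [NonUnitalCStarAlgebra B] :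
    Type (max u v) :=
  UniversalCStar (freeProductPres A B)

/-- Generators `⊔ₖ A k`, subject to the relations that every `A k` is mapped by a
`*`-homomorphism and that `a ∈ A k` and `γ k a ∈ A (k + 1)` have the same image. The norm bound on
the generators is again automatic. -/
def inductiveLimitPres {A : ℕ → Type u} [∀ k, NonUnitalCStarAlgebra (A k)]
    (γ : ∀ k, A k →⋆ₙₐ[ℂ] A (k + 1)) : CStarPresentation (Σ k, A k) where
  bound x := ‖x.2‖₊
  rel := {r | (∃ k, StarHomRel (Sigma.mk k) r) ∨
    ∃ k a, r = FreeStarAlg.of ⟨k + 1, γ k a⟩ - FreeStarAlg.of ⟨k, a⟩}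

/-- The inductive limit of a sequence of C*-algebras: the universal C*-algebra generated by
`*`-homomorphic images of all the `A k` that are compatible with the connecting morphisms. -/
abbrev InductiveLimit {A : ℕ → Type u} [∀ k, NonUnitalCStarAlgebra (A k)]
    (γ : ∀ k, A k →⋆ₙₐ[ℂ] A (k + 1)) : Type u :=
  UniversalCStar (inductiveLimitPres γ)

/-! ### Projective and semiprojective C*-algebras -/

/-- `π : C → D` is (up to isomorphism) the quotient morphism `C → C/J`. -/
def IsQuotientBy {C : Type u} {D : Type v} [NonUnitalCStarAlgebra C] [NonUnitalCStarAlgebra D]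
    (π : C →⋆ₙₐ[ℂ] D) (J : Set C) : Prop :=
  Function.Surjective π ∧ ∀ x, π x = 0 ↔ x ∈ J

/-- A morphism `φ : A → B` is projective if for every quotient morphism `π : C → C/J` by a closed
ideal and every `σ : B → C/J` there is `ψ : A → C` with `π ∘ ψ = σ ∘ φ`. -/
def IsProjectiveMorphism {A B : Type u} [NonUnitalCStarAlgebra A] [NonUnitalCStarAlgebra B]
    (φ : A →⋆ₙₐ[ℂ] B) : Prop :=
  ∀ (C D : Type u) [NonUnitalCStarAlgebra C] [NonUnitalCStarAlgebra D]
    (J : TwoSidedIdeal C), IsClosed (J : Set C) →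
    ∀ π : C →⋆ₙₐ[ℂ] D, IsQuotientBy π (J : Set C) →
    ∀ σ : B →⋆ₙₐ[ℂ] D, ∃ ψ : A →⋆ₙₐ[ℂ] C, π.comp ψ = σ.comp φ

/-- A C*-algebra is projective if its identity morphism is. -/
def IsProjectiveCStar (A : Type u) [NonUnitalCStarAlgebra A] : Prop :=
  IsProjectiveMorphism (NonUnitalStarAlgHom.id ℂ A)

/-- A morphism `φ : A → B` is semiprojective if for every increasing sequence of closed ideals
`J k` of `C`, with `D = C / closure (⋃ k, J k)`, and every `σ : B → D` there are `k` and
`ψ : A → C / J k` with `ρ ∘ ψ = σ ∘ φ`. Here `Q k` is `C / J k`, with quotient morphism `q k`,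
and `ρ : Q k → D` is the induced morphism, determined by `ρ ∘ q k = π`. -/
def IsSemiprojectiveMorphism {A B : Type u} [NonUnitalCStarAlgebra A] [NonUnitalCStarAlgebra B]
    (φ : A →⋆ₙₐ[ℂ] B) : Prop :=
  ∀ (C D : Type u) [NonUnitalCStarAlgebra C] [NonUnitalCStarAlgebra D]
    (Q : ℕ → Type u) [∀ k, NonUnitalCStarAlgebra (Q k)]
    (J : ℕ → TwoSidedIdeal C), Monotone J → (∀ k, IsClosed (J k : Set C)) →
    ∀ q : ∀ k, C →⋆ₙₐ[ℂ] Q k, (∀ k, IsQuotientBy (q k) (J k : Set C)) →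
    ∀ π : C →⋆ₙₐ[ℂ] D, IsQuotientBy π (closure (⋃ k, (J k : Set C))) →
    ∀ σ : B →⋆ₙₐ[ℂ] D, ∃ (k : ℕ) (ψ : A →⋆ₙₐ[ℂ] Q k) (ρ : Q k →⋆ₙₐ[ℂ] D),
      ρ.comp (q k) = π ∧ ρ.comp ψ = σ.comp φ

/-- A C*-algebra is semiprojective if its identity morphism is. -/
def IsSemiprojectiveCStar (A : Type u) [NonUnitalCStarAlgebra A] : Prop :=
  IsSemiprojectiveMorphism (NonUnitalStarAlgHom.id ℂ A)

end

noncomputable section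

open UniformSpace

universe w

/-! ### Lifting contractions along `*`-homomorphisms -/

section Lifting

variable {C : Type u} {D : Type v} [NonUnitalCStarAlgebra C] [NonUnitalCStarAlgebra D]

/-! The generators of `FInfty` serve both to make the connecting morphisms surjective and to feed
everything back into the original system. The morphism `δ k` extends `γ k`, sends `x_{2m}` to the
`m`-th term of a sequence of contractions generating `A (k + 1)`, and sends `x_{2m+1}` to `x_m`. Its
image contains generators of both free factors; since the range of a `*`-homomorphism of C*-algebras
is closed, `δ k` is onto (`connectingHom_surjective`).

The limit does not change because no generator survives forever. An odd index drops strictly at each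
stage and an even index, in particular `0`, falls into the next `A`. If `n` has `t` trailing ones in
binary, then `x_n` at stage `k` lands in `A (k + t + 1)`. Recording the landing point (`limitGen`)
gives compatible maps from `FreeProduct (A k) FInfty` to the limit of the `A k`, hence an inverse to
the morphism induced by the inclusions `A k → FreeProduct (A k) FInfty` (`limitHom_limitGen`).

(Semi)projectivity passes to the free product because the two factors can be lifted separately, and
`FInfty` lifts along every surjection: contractions lift to contractions
(`exists_contraction_map_eq`). The same lifting, after scaling, yields closed ranges. -/

theorem continuous_starAlgHom (φ : C →⋆ₙₐ[ℂ] D) : Continuous φ :=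
  AddMonoidHomClass.continuous_of_bound φ 1 fun c => by
    simpa using NonUnitalStarAlgHom.norm_apply_le φ c

/-- An element of the quasispectrum of a self-adjoint element is bounded by the norm. -/
theorem abs_le_norm_of_mem_quasispectrum {a : C} (ha : IsSelfAdjoint a) {t : ℝ}
    (ht : t ∈ quasispectrum ℝ a) : |t| ≤ ‖a‖ := by
  have := norm_apply_le_norm_cfcₙ (fun t : ℝ => t) a ht
  rwa [cfcₙ_id' ℝ a] at this

/-- A contraction in the range of a `*`-homomorphism is the image of a contraction. -/
theorem exists_contraction_map_eq (φ : C →⋆ₙₐ[ℂ] D) (c : C) (hc : ‖φ c‖ ≤ 1) :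
    ∃ c', φ c' = φ c ∧ ‖c'‖ ≤ 1 := by
  -- The aim is to multiply `c` by `max(1, |t|)^(-1/2)` evaluated at `c* c`. That function is `1` at
  -- `0`, so the non-unital calculus is applied to its difference `g` from `1`, and the new lift is
  -- `c - c * y`.
  let g : ℝ → ℝ := fun t => 1 - (√(max 1 |t|))⁻¹
  have hpos : ∀ t : ℝ, 0 < √(max 1 |t|) := fun t => Real.sqrt_pos.2 (by positivity)
  have hg : Continuous g := by
    have : Continuous fun t : ℝ => √(max 1 |t|) := by fun_prop
    exact continuous_const.sub (this.inv₀ fun t => (hpos t).ne')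
  have hg0 : g 0 = 0 := by simp [g]
  have hsa : IsSelfAdjoint (star c * c) := IsSelfAdjoint.star_mul_self c
  set y := cfcₙ g (star c * c) with hy
  have hysa : star y = y := (cfcₙ_predicate g (star c * c) : IsSelfAdjoint _)
  refine ⟨c - c * y, ?_, ?_⟩
  · have hφy : φ y = 0 := by
      have hsa' : IsSelfAdjoint (φ (star c * c)) := hsa.map φ
      rw [hy, NonUnitalStarAlgHomClass.map_cfcₙ φ g (star c * c) hg.continuousOn hg0
        (continuous_starAlgHom φ) hsa hsa']
      -- Since `‖φ c‖ ≤ 1`, the quasispectrum of `φ (c* c)` lies in `[-1, 1]`, where `g` vanishes.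
      have : (quasispectrum ℝ (φ (star c * c))).EqOn g (fun _ => 0) := fun t ht => by
        have h1 := abs_le_norm_of_mem_quasispectrum hsa' ht
        have h2 : ‖φ (star c * c)‖ ≤ 1 := by
          rw [map_mul, map_star, CStarRing.norm_star_mul_self]
          exact mul_le_one₀ hc (norm_nonneg _) hc
        simp [g, max_eq_left (h1.trans h2)]
      rw [cfcₙ_congr this, cfcₙ_const_zero]
    rw [map_sub, map_mul, hφy, mul_zero, sub_zero]
  · have hx : cfcₙ (fun t : ℝ => t) (star c * c) = star c * c := cfcₙ_id' ℝ _
    -- As `y` is self-adjoint, the product is `(1 - y) c* c (1 - y)` in the unitization, a function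
    -- of `c* c` alone. That function simplifies to `t / max 1 |t|`, which is bounded by `1`.
    have key : star (c - c * y) * (c - c * y) =
        cfcₙ (fun t => (t - t * g t) - g t * (t - t * g t)) (star c * c) := by
      have h1 : cfcₙ (fun t => t - t * g t) (star c * c) = star c * c - star c * c * y := by
        rw [cfcₙ_sub (fun t => t) (fun t => t * g t) (star c * c) (by fun_prop) (by simp)
            (by fun_prop) (by simp),
          cfcₙ_mul (fun t => t) g (star c * c) (by fun_prop) (by simp)
            (by fun_prop) (by simpa), hx]
      rw [cfcₙ_sub (fun t => t - t * g t) (fun t => g t * (t - t * g t)) (star c * c)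
          (by fun_prop) (by simp) (by fun_prop) (by simp),
        cfcₙ_mul g (fun t => t - t * g t) (star c * c) (by fun_prop) hg0
          (by fun_prop) (by simp), h1, star_sub, star_mul, hysa]
      noncomm_ring
    have hle : ‖star (c - c * y) * (c - c * y)‖ ≤ 1 := by
      rw [key]
      refine norm_cfcₙ_le fun t _ => ?_
      have hm : (0 : ℝ) < max 1 |t| := by positivity
      have : (t - t * g t) - g t * (t - t * g t) = t * (max 1 |t|)⁻¹ := by
        calc (t - t * g t) - g t * (t - t * g t) = t * ((√(max 1 |t|))⁻¹ * (√(max 1 |t|))⁻¹) := by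
              simp only [g]; ring
          _ = _ := by rw [← mul_inv, Real.mul_self_sqrt hm.le]
      rw [this, Real.norm_eq_abs, abs_mul, abs_inv, abs_of_pos hm, ← div_eq_mul_inv]
      exact div_le_one_of_le₀ (le_max_right _ _) hm.le
    rw [CStarRing.norm_star_mul_self] at hle
    nlinarith [norm_nonneg (c - c * y)]

/-- An element of the range of a `*`-homomorphism is the image of an element of at most the same
norm. -/
theorem exists_map_eq_norm_le (φ : C →⋆ₙₐ[ℂ] D) (c : C) :
    ∃ c', φ c' = φ c ∧ ‖c'‖ ≤ ‖φ c‖ := by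
  rcases eq_or_ne (φ c) 0 with h | h
  · exact ⟨0, by simp [h], by simp⟩
  have hn : ‖φ c‖ ≠ 0 := norm_ne_zero_iff.2 h
  have hn' : (‖φ c‖ : ℂ) ≠ 0 := by exact_mod_cast hn
  obtain ⟨c', h1, h2⟩ := exists_contraction_map_eq φ ((‖φ c‖ : ℂ)⁻¹ • c) (by
    rw [map_smul, norm_smul]; simp [hn])
  refine ⟨(‖φ c‖ : ℂ) • c', by rw [map_smul, h1, map_smul, smul_inv_smul₀ hn'], ?_⟩
  rw [norm_smul]
  simpa using mul_le_of_le_one_right (norm_nonneg (φ c)) h2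

/-- The range of a `*`-homomorphism between C*-algebras is closed. -/
theorem isClosed_range_starAlgHom (φ : C →⋆ₙₐ[ℂ] D) : IsClosed (Set.range φ) := by
  let f : NormedAddGroupHom C D :=
    (φ : C →+ D).mkNormedAddGroupHom 1 fun c => by
      simpa using NonUnitalStarAlgHom.norm_apply_le φ c
  have hf : f.SurjectiveOnWith f.range 1 := by
    rintro _ ⟨c, rfl⟩
    obtain ⟨c', h1, h2⟩ := exists_map_eq_norm_le φ c
    exact ⟨c', h1, h2.trans_eq (one_mul _).symm⟩
  -- Norm-controlled preimages on the range extend to its closure by summing a convergent series in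
  -- the complete domain. The loss in the constant is irrelevant here.
  have := controlled_closure_of_complete one_pos one_pos hf
  refine isClosed_of_closure_subset fun d hd => ?_
  have hd' : d ∈ f.range.topologicalClosure := hd
  obtain ⟨c, hc, -⟩ := this d hd'
  exact ⟨c, hc⟩

end Lifting

/-! ### The universal property -/

namespace FreeStarAlg

variable {X : Type u} {E : Type v} [NonUnitalCStarAlgebra E]

/-- The `*`-homomorphism on the free `*`-algebra determined by the images of the generators. -/
def lift (f : X → E) : FreeStarAlg X →⋆ₙₐ[ℂ] E :=
  let F : FreeStarAlg X →ₙₐ[ℂ] E :=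
    MonoidAlgebra.liftMagma ℂ (FreeSemigroup.lift (Sum.elim f fun x => star (f x)))
  have hF : ∀ w c, F (single w c) =
      c • FreeSemigroup.lift (Sum.elim f fun x => star (f x)) w := fun w c => by
    exact (Finsupp.liftAddHom_apply_single _ w c).trans rfl
  have hstar : ∀ w : FreeSemigroup (X ⊕ X),
      FreeSemigroup.lift (Sum.elim f fun x => star (f x)) (starWord w).unop =
      star (FreeSemigroup.lift (Sum.elim f fun x => star (f x)) w) := fun w => by
    induction w with
    | ih1 l => rcases l with x | x <;> simp [starWord]
    | ih2 l w h1 h2 => simp only [map_mul, MulOpposite.unop_mul, h1, h2, star_mul]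
  { F with
    map_star' := fun a => by
      -- Both sides are additive, so it suffices to compare them on monomials.
      have : (F : FreeStarAlg X →+ E).comp (starAddEquiv (R := FreeStarAlg X)).toAddMonoidHom =
          (starAddEquiv (R := E)).toAddMonoidHom.comp (F : FreeStarAlg X →+ E) :=
        addHom_ext fun w c => by
          change F (star (single w c)) = star (F (single w c))
          rw [star_single, hF, hF, star_smul, hstar]
      exact DFunLike.congr_fun this a }

theorem lift_of (f : X → E) (x : X) : lift f (of x) = f x := by
  refine (Finsupp.liftAddHom_apply_single _ (FreeSemigroup.of (Sum.inl x)) (1 : ℂ)).trans ?_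
  simp

/-- The free `*`-algebra is generated by the generators. -/
theorem mem_of_forall_of_mem (S : NonUnitalStarSubalgebra ℂ (FreeStarAlg X))
    (h : ∀ x, of x ∈ S) (a : FreeStarAlg X) : a ∈ S := by
  have hw : ∀ w : FreeSemigroup (X ⊕ X), single w 1 ∈ S := fun w => by
    induction w with
    | ih1 l =>
      rcases l with x | x
      · exact h x
      · have : single (FreeSemigroup.of (Sum.inr x)) 1 = star (of x) := by
          simp [of, star_single, starWord]
        rw [this]
        exact star_mem (h x)
    | ih2 l w h1 h2 =>
      have := mul_mem h1 h2
      rwa [single_mul, one_mul] at this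
  have : ∀ f : FreeSemigroup (X ⊕ X) →₀ ℂ, (MonoidAlgebra.ofCoeff f : FreeStarAlg X) ∈ S := by
    intro f
    induction f using Finsupp.induction_linear with
    | zero => exact zero_mem S
    | add f g hf hg => exact add_mem hf hg
    | single w c =>
      have := SMulMemClass.smul_mem c (hw w)
      rwa [smul_single, mul_one] at this
  exact this (MonoidAlgebra.coeff a)

end FreeStarAlg

namespace UniversalCStar

variable {X : Type u} {P : CStarPresentation X} {E : Type v} [NonUnitalCStarAlgebra E]

/-- `mk` as a `*`-homomorphism on the free `*`-algebra. -/
def mkHom (P : CStarPresentation X) : FreeStarAlg X →⋆ₙₐ[ℂ] UniversalCStar P where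
  toFun a := mk (P.toPre a)
  map_smul' c _ := mk_smul c _
  map_zero' := mk_zero
  map_add' _ _ := mk_add _ _
  map_mul' _ _ := mk_mul _ _
  map_star' _ := mk_star _

theorem mkHom_of (x : X) : mkHom P (FreeStarAlg.of x) = of x := rfl

/-- The largest admissible seminorm kills every relation, and the completion separates points. -/
theorem mkHom_eq_zero {r : FreeStarAlg X} (hr : r ∈ P.rel) : mkHom P r = 0 :=
  norm_eq_zero.1 ((norm_mk (P.toPre r)).trans (P.admissible_maxSeminorm.rel_eq_zero r hr))

theorem norm_of_le (x : X) : ‖(of x : UniversalCStar P)‖ ≤ P.bound x :=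
  (norm_mk _).trans_le (P.admissible_maxSeminorm.le_bound x)

/-- A closed `*`-subalgebra that contains the generators is everything. -/
theorem mem_of_isClosed (S : NonUnitalStarSubalgebra ℂ (UniversalCStar P))
    (hS : IsClosed (S : Set (UniversalCStar P))) (h : ∀ x, of x ∈ S) (a : UniversalCStar P) :
    a ∈ S :=
  induction₁ a hS fun a =>
    FreeStarAlg.mem_of_forall_of_mem (S.comap (mkHom P)) (fun x => h x) a

/-- Morphisms are automatically continuous, so their equalizer is a closed `*`-subalgebra. -/
theorem hom_ext {φ ψ : UniversalCStar P →⋆ₙₐ[ℂ] E} (h : ∀ x, φ (of x) = ψ (of x)) : φ = ψ :=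
  NonUnitalStarAlgHom.ext <| mem_of_isClosed (NonUnitalStarAlgHom.equalizer φ ψ)
    (isClosed_eq (continuous_starAlgHom φ) (continuous_starAlgHom ψ)) h

/-- Pulling the norm of `E` back along the free lift gives an admissible C*-seminorm, and the norm
of `P.Pre` is the supremum of these. This is what lets the free lift extend to the completion. -/
theorem norm_freeLift_le (f : X → E) (hb : ∀ x, ‖f x‖ ≤ P.bound x)
    (hr : ∀ r ∈ P.rel, FreeStarAlg.lift f r = 0) (a : P.Pre) : ‖FreeStarAlg.lift f a‖ ≤ ‖a‖ := by
  let p : Seminorm ℂ (FreeStarAlg X) :=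
    (normSeminorm ℂ E).comp (FreeStarAlg.lift f : FreeStarAlg X →ₗ[ℂ] E)
  have hp : P.Admissible p :=
    { mul_le := fun a b => by
        change ‖FreeStarAlg.lift f (a * b)‖ ≤ ‖FreeStarAlg.lift f a‖ * ‖FreeStarAlg.lift f b‖
        rw [map_mul]
        exact norm_mul_le _ _
      star_mul_self := fun a => by
        change ‖FreeStarAlg.lift f (star a * a)‖ = ‖FreeStarAlg.lift f a‖ * ‖FreeStarAlg.lift f a‖
        rw [map_mul, map_star, CStarRing.norm_star_mul_self]
      le_bound := fun x => by
        change ‖FreeStarAlg.lift f (FreeStarAlg.of x)‖ ≤ _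
        rw [FreeStarAlg.lift_of]
        exact hb x
      rel_eq_zero := fun r h => by
        change ‖FreeStarAlg.lift f r‖ = 0
        rw [hr r h, norm_zero] }
  exact hp.le_maxNorm a

theorem uniformContinuous_freeLift (f : X → E) (hb : ∀ x, ‖f x‖ ≤ P.bound x)
    (hr : ∀ r ∈ P.rel, FreeStarAlg.lift f r = 0) :
    UniformContinuous fun a : P.Pre => FreeStarAlg.lift f a := by
  let F : P.Pre →+ E := (FreeStarAlg.lift f : FreeStarAlg X →+ E)
  exact (AddMonoidHomClass.lipschitz_of_bound F 1 fun a =>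
    (norm_freeLift_le f hb hr a).trans_eq (one_mul _).symm).uniformContinuous

/-- The universal property: images of the generators that satisfy the bounds and the relations
extend to a `*`-homomorphism. -/
def lift (f : X → E) (hb : ∀ x, ‖f x‖ ≤ P.bound x)
    (hr : ∀ r ∈ P.rel, FreeStarAlg.lift f r = 0) :
    UniversalCStar P →⋆ₙₐ[ℂ] E :=
  let F : UniversalCStar P → E := Completion.extension fun a : P.Pre => FreeStarAlg.lift f a
  have hF : ∀ a : P.Pre, F (mk a) = FreeStarAlg.lift f a :=
    Completion.extension_coe (uniformContinuous_freeLift f hb hr)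
  have hc : Continuous F := Completion.continuous_extension
  { toFun := F
    map_smul' := fun c a => induction₁ a
      (isClosed_eq (hc.comp (continuous_id.const_smul c)) (hc.const_smul c))
      fun a => by rw [← mk_smul, hF, hF]; exact map_smul (FreeStarAlg.lift f) c a
    map_zero' := by rw [← mk_zero, hF]; exact map_zero (FreeStarAlg.lift f)
    map_add' := fun a b => induction₂ a b (isClosed_eq (by fun_prop) (by fun_prop))
      fun a b => by rw [← mk_add, hF, hF, hF]; exact map_add (FreeStarAlg.lift f) a b
    map_mul' := fun a b => induction₂ a b (isClosed_eq (by fun_prop) (by fun_prop))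
      fun a b => by rw [← mk_mul, hF, hF, hF]; exact map_mul (FreeStarAlg.lift f) a b
    map_star' := fun a => induction₁ a (isClosed_eq (by fun_prop) (by fun_prop))
      fun a => by rw [← mk_star, hF, hF]; exact map_star (FreeStarAlg.lift f) a }

theorem lift_of (f : X → E) (hb : ∀ x, ‖f x‖ ≤ P.bound x)
    (hr : ∀ r ∈ P.rel, FreeStarAlg.lift f r = 0) (x : X) :
    lift f hb hr (of x) = f x :=
  (Completion.extension_coe (uniformContinuous_freeLift f hb hr)
    (P.toPre (FreeStarAlg.of x))).trans (FreeStarAlg.lift_of f x)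

/-- The `*`-homomorphism onto the generators `j a` given by the relations `StarHomRel j`. -/
def homOfRel {A : Type v} [NonUnitalCStarAlgebra A] (P : CStarPresentation X) (j : A → X)
    (h : ∀ r, StarHomRel j r → r ∈ P.rel) : A →⋆ₙₐ[ℂ] UniversalCStar P where
  toFun a := of (j a)
  map_smul' c a := by
    simpa [sub_eq_zero, mkHom_of] using mkHom_eq_zero (h _ (.smul c a))
  -- No relation names zero; it comes from the scalar relation with scalar `0`.
  map_zero' := by
    simpa [sub_eq_zero, mkHom_of] using mkHom_eq_zero (h _ (.smul 0 0))
  map_add' a b := by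
    simpa [sub_eq_zero, mkHom_of] using mkHom_eq_zero (h _ (.add a b))
  map_mul' a b := by
    simpa [sub_eq_zero, mkHom_of] using mkHom_eq_zero (h _ (.mul a b))
  map_star' a := by
    simpa [sub_eq_zero, mkHom_of, map_star] using mkHom_eq_zero (h _ (.star a))

end UniversalCStar

/-- Discharges the relation hypothesis of `UniversalCStar.lift` for both free products and inductive
limits. -/
theorem FreeStarAlg.lift_eq_zero_of_starHomRel {X : Type u} {E : Type v} {A : Type w}
    [NonUnitalCStarAlgebra E] [NonUnitalCStarAlgebra A] {j : A → X} {f : X → E}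
    (φ : A →⋆ₙₐ[ℂ] E) (hφ : ∀ a, f (j a) = φ a) {r : FreeStarAlg X} (hr : StarHomRel j r) :
    FreeStarAlg.lift f r = 0 := by
  cases hr <;> simp [FreeStarAlg.lift_of, hφ, map_sub, map_add, map_mul, map_star, map_smul]

/-! ### The free C*-algebra on countably many contractions -/

namespace FInfty

variable {E : Type v} [NonUnitalCStarAlgebra E]

/-- The generators of `FInfty`. -/
def gen (n : ℕ) : FInfty := UniversalCStar.of n

theorem norm_gen_le (n : ℕ) : ‖gen n‖ ≤ 1 := UniversalCStar.norm_of_le n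

/-- A sequence of contractions defines a `*`-homomorphism on `FInfty`. -/
def lift (f : ℕ → E) (hf : ∀ n, ‖f n‖ ≤ 1) : FInfty →⋆ₙₐ[ℂ] E :=
  UniversalCStar.lift f hf fun r hr => absurd hr (Set.notMem_empty r)

theorem lift_gen (f : ℕ → E) (hf : ∀ n, ‖f n‖ ≤ 1) (n : ℕ) : lift f hf (gen n) = f n :=
  UniversalCStar.lift_of ..

theorem hom_ext {φ ψ : FInfty →⋆ₙₐ[ℂ] E} (h : ∀ n, φ (gen n) = ψ (gen n)) : φ = ψ :=
  UniversalCStar.hom_ext h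

/-- `*`-homomorphisms from `FInfty` lift along surjections. -/
theorem exists_lift {D : Type w} [NonUnitalCStarAlgebra D] (π : E →⋆ₙₐ[ℂ] D)
    (hπ : Function.Surjective π) (σ : FInfty →⋆ₙₐ[ℂ] D) : ∃ ψ : FInfty →⋆ₙₐ[ℂ] E, π.comp ψ = σ := by
  -- The norm bounds are the only constraints on the generators, so contractive lifts chosen one by
  -- one suffice.
  have : ∀ n, ∃ c, π c = σ (gen n) ∧ ‖c‖ ≤ 1 := fun n => by
    obtain ⟨c, hc⟩ := hπ (σ (gen n))
    rw [← hc]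
    refine exists_contraction_map_eq π c ?_
    rw [hc]
    exact (NonUnitalStarAlgHom.norm_apply_le σ _).trans (norm_gen_le n)
  choose f hf hf1 using this
  refine ⟨lift f hf1, hom_ext fun n => ?_⟩
  rw [NonUnitalStarAlgHom.comp_apply, lift_gen, hf]

end FInfty

/-! ### Free products -/

namespace FreeProduct

variable {A : Type u} {B : Type v} [NonUnitalCStarAlgebra A] [NonUnitalCStarAlgebra B]
  {E : Type w} [NonUnitalCStarAlgebra E]

/-- The first factor. -/
def inl : A →⋆ₙₐ[ℂ] FreeProduct A B :=
  UniversalCStar.homOfRel _ Sum.inl fun _ => Or.inl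

/-- The second factor. -/
def inr : B →⋆ₙₐ[ℂ] FreeProduct A B :=
  UniversalCStar.homOfRel _ Sum.inr fun _ => Or.inr

/-- The universal property of the free product. -/
def lift (φ : A →⋆ₙₐ[ℂ] E) (ψ : B →⋆ₙₐ[ℂ] E) : FreeProduct A B →⋆ₙₐ[ℂ] E :=
  UniversalCStar.lift (Sum.elim φ ψ)
    (by rintro (a | b)
        · exact NonUnitalStarAlgHom.norm_apply_le φ a
        · exact NonUnitalStarAlgHom.norm_apply_le ψ b)
    (by rintro r (hr | hr)
        · exact FreeStarAlg.lift_eq_zero_of_starHomRel (j := Sum.inl) φ (fun _ => rfl) hr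
        · exact FreeStarAlg.lift_eq_zero_of_starHomRel (j := Sum.inr) ψ (fun _ => rfl) hr)

theorem lift_comp_inl (φ : A →⋆ₙₐ[ℂ] E) (ψ : B →⋆ₙₐ[ℂ] E) : (lift φ ψ).comp inl = φ :=
  NonUnitalStarAlgHom.ext fun a => by
    rw [NonUnitalStarAlgHom.comp_apply, lift]
    exact UniversalCStar.lift_of _ _ _ (Sum.inl a)

theorem lift_comp_inr (φ : A →⋆ₙₐ[ℂ] E) (ψ : B →⋆ₙₐ[ℂ] E) : (lift φ ψ).comp inr = ψ :=
  NonUnitalStarAlgHom.ext fun b => by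
    rw [NonUnitalStarAlgHom.comp_apply, lift]
    exact UniversalCStar.lift_of _ _ _ (Sum.inr b)

theorem hom_ext {φ ψ : FreeProduct A B →⋆ₙₐ[ℂ] E} (hl : φ.comp inl = ψ.comp inl)
    (hr : φ.comp inr = ψ.comp inr) : φ = ψ :=
  UniversalCStar.hom_ext <| by
    rintro (a | b)
    · exact DFunLike.congr_fun hl a
    · exact DFunLike.congr_fun hr b

/-- A closed `*`-subalgebra that contains both factors is everything. -/
theorem mem_of_isClosed (S : NonUnitalStarSubalgebra ℂ (FreeProduct A B))
    (hS : IsClosed (S : Set (FreeProduct A B))) (hl : ∀ a, inl a ∈ S) (hr : ∀ b, inr b ∈ S)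
    (x : FreeProduct A B) : x ∈ S :=
  UniversalCStar.mem_of_isClosed S hS (by rintro (a | b); exacts [hl a, hr b]) x

end FreeProduct

/-! ### Permanence of projectivity and semiprojectivity -/

/-- The free product of a projective C*-algebra with `FInfty` is projective. -/
theorem IsProjectiveCStar.freeProduct_fInfty {A : Type u} [NonUnitalCStarAlgebra A]
    (h : IsProjectiveCStar A) : IsProjectiveCStar (FreeProduct A FInfty) := by
  intro C D _ _ J hJ π hπ σ
  obtain ⟨ψ₁, h₁⟩ := h C D J hJ π hπ (σ.comp FreeProduct.inl)
  -- This lift need not be coordinated with `ψ₁`: a free product imposes no relations between its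
  -- factors.
  obtain ⟨ψ₂, h₂⟩ := FInfty.exists_lift π hπ.1 (σ.comp FreeProduct.inr)
  refine ⟨FreeProduct.lift ψ₁ ψ₂, FreeProduct.hom_ext ?_ ?_⟩
  · rw [NonUnitalStarAlgHom.comp_assoc, FreeProduct.lift_comp_inl, h₁]; rfl
  · rw [NonUnitalStarAlgHom.comp_assoc, FreeProduct.lift_comp_inr, h₂]; rfl

/-- The free product of a semiprojective C*-algebra with `FInfty` is semiprojective. -/
theorem IsSemiprojectiveCStar.freeProduct_fInfty {A : Type u} [NonUnitalCStarAlgebra A]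
    (h : IsSemiprojectiveCStar A) : IsSemiprojectiveCStar (FreeProduct A FInfty) := by
  intro C D _ _ Q _ J hmono hJ q hq π hπ σ
  obtain ⟨k, ψ₁, ρ, hρ, h₁⟩ := h C D Q J hmono hJ q hq π hπ (σ.comp FreeProduct.inl)
  -- The stage `k` is dictated by `A` alone; `FInfty` then lifts to that same stage because `ρ` is
  -- onto.
  have hsurj : Function.Surjective ρ := fun d => by
    obtain ⟨c, rfl⟩ := hπ.1 d
    exact ⟨q k c, DFunLike.congr_fun hρ c⟩
  obtain ⟨ψ₂, h₂⟩ := FInfty.exists_lift ρ hsurj (σ.comp FreeProduct.inr)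
  refine ⟨k, FreeProduct.lift ψ₁ ψ₂, ρ, hρ, FreeProduct.hom_ext ?_ ?_⟩
  · rw [NonUnitalStarAlgHom.comp_assoc, FreeProduct.lift_comp_inl, h₁]; rfl
  · rw [NonUnitalStarAlgHom.comp_assoc, FreeProduct.lift_comp_inr, h₂]; rfl

/-! ### Inductive limits -/

namespace InductiveLimit

variable {A : ℕ → Type u} [∀ k, NonUnitalCStarAlgebra (A k)] (γ : ∀ k, A k →⋆ₙₐ[ℂ] A (k + 1))
  {E : Type v} [NonUnitalCStarAlgebra E]

/-- The canonical morphism from `A k` to the inductive limit. -/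
def incl (k : ℕ) : A k →⋆ₙₐ[ℂ] InductiveLimit γ :=
  UniversalCStar.homOfRel _ (Sigma.mk k) fun _ hr => Or.inl ⟨k, hr⟩

theorem incl_comp (k : ℕ) : (incl γ (k + 1)).comp (γ k) = incl γ k :=
  NonUnitalStarAlgHom.ext fun a => by
    have := UniversalCStar.mkHom_eq_zero (P := inductiveLimitPres γ) (Or.inr ⟨k, a, rfl⟩)
    rw [map_sub, sub_eq_zero] at this
    exact this

variable {γ}

/-- The universal property of the inductive limit. -/
def lift (φ : ∀ k, A k →⋆ₙₐ[ℂ] E) (hφ : ∀ k, (φ (k + 1)).comp (γ k) = φ k) :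
    InductiveLimit γ →⋆ₙₐ[ℂ] E :=
  UniversalCStar.lift (fun x => φ x.1 x.2) (fun x => NonUnitalStarAlgHom.norm_apply_le (φ x.1) x.2)
    (by rintro r (⟨k, hr⟩ | ⟨k, a, rfl⟩)
        · exact FreeStarAlg.lift_eq_zero_of_starHomRel (j := Sigma.mk k) (φ k) (fun _ => rfl) hr
        · rw [map_sub, FreeStarAlg.lift_of, FreeStarAlg.lift_of, sub_eq_zero]
          exact DFunLike.congr_fun (hφ k) a)

theorem lift_comp_incl (φ : ∀ k, A k →⋆ₙₐ[ℂ] E) (hφ : ∀ k, (φ (k + 1)).comp (γ k) = φ k) (k : ℕ) :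
    (lift φ hφ).comp (incl γ k) = φ k :=
  NonUnitalStarAlgHom.ext fun a => by
    rw [NonUnitalStarAlgHom.comp_apply, lift]
    exact UniversalCStar.lift_of (fun x : Σ k, A k => φ x.1 x.2) _ _ ⟨k, a⟩

theorem hom_ext {φ ψ : InductiveLimit γ →⋆ₙₐ[ℂ] E}
    (h : ∀ k, φ.comp (incl γ k) = ψ.comp (incl γ k)) : φ = ψ :=
  UniversalCStar.hom_ext fun x => DFunLike.congr_fun (h x.1) x.2

end InductiveLimit

/-! ### The surjective inductive system -/

/-- A sequence of contractions with dense linear span: a dense sequence, scaled into the unit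
ball. -/
def contractionSeq (A : Type u) [NonUnitalCStarAlgebra A] [TopologicalSpace.SeparableSpace A]
    (n : ℕ) : A :=
  ((max 1 ‖TopologicalSpace.denseSeq A n‖ : ℝ) : ℂ)⁻¹ • TopologicalSpace.denseSeq A n

theorem norm_contractionSeq_le (A : Type u) [NonUnitalCStarAlgebra A]
    [TopologicalSpace.SeparableSpace A] (n : ℕ) : ‖contractionSeq A n‖ ≤ 1 := by
  have h : (0 : ℝ) < max 1 ‖TopologicalSpace.denseSeq A n‖ := by positivity
  rw [contractionSeq, norm_smul, norm_inv, Complex.norm_real, Real.norm_of_nonneg h.le,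
    inv_mul_le_one₀ h]
  exact le_max_right _ _

/-- A closed `*`-subalgebra that contains `contractionSeq A` is everything. -/
theorem mem_of_contractionSeq_mem {A : Type u} [NonUnitalCStarAlgebra A]
    [TopologicalSpace.SeparableSpace A] (S : NonUnitalStarSubalgebra ℂ A)
    (hS : IsClosed (S : Set A)) (h : ∀ n, contractionSeq A n ∈ S) (a : A) : a ∈ S := by
  refine hS.closure_subset_iff.2 ?_ (TopologicalSpace.denseRange_denseSeq A a)
  rintro _ ⟨n, rfl⟩
  have h0 : ((max 1 ‖TopologicalSpace.denseSeq A n‖ : ℝ) : ℂ) ≠ 0 := by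
    exact_mod_cast (by positivity : (0 : ℝ) < max 1 ‖TopologicalSpace.denseSeq A n‖).ne'
  have := SMulMemClass.smul_mem ((max 1 ‖TopologicalSpace.denseSeq A n‖ : ℝ) : ℂ) (h n)
  rwa [contractionSeq, smul_inv_smul₀ h0] at this

/-! ### The connecting morphisms and their surjectivity -/

section Connecting

variable {A A' : Type u} [NonUnitalCStarAlgebra A] [NonUnitalCStarAlgebra A']
  [TopologicalSpace.SeparableSpace A']

/-- The images of the generators of `FInfty` under the connecting morphism: those of even index
enumerate contractions that generate `A'`, those of odd index `2 j + 1` go to the generator of the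
smaller index `j`. -/
def connectingSeq (A' : Type u) [NonUnitalCStarAlgebra A'] [TopologicalSpace.SeparableSpace A']
    (n : ℕ) : FreeProduct A' FInfty :=
  if Even n then FreeProduct.inl (contractionSeq A' (n / 2))
  else FreeProduct.inr (FInfty.gen (n / 2))

theorem connectingSeq_two_mul (n : ℕ) :
    connectingSeq A' (2 * n) = FreeProduct.inl (contractionSeq A' n) := by
  simp [connectingSeq]

theorem connectingSeq_two_mul_add_one (n : ℕ) :
    connectingSeq A' (2 * n + 1) = FreeProduct.inr (FInfty.gen n) := by
  have : (2 * n + 1) / 2 = n := by omega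
  simp [connectingSeq, this]

theorem norm_connectingSeq_le (n : ℕ) : ‖connectingSeq A' n‖ ≤ 1 := by
  unfold connectingSeq
  split_ifs
  · exact (NonUnitalStarAlgHom.norm_apply_le _ _).trans (norm_contractionSeq_le A' _)
  · exact (NonUnitalStarAlgHom.norm_apply_le _ _).trans (FInfty.norm_gen_le _)

/-- The surjective connecting morphism that extends `γ`. -/
def connectingHom (γ : A →⋆ₙₐ[ℂ] A') : FreeProduct A FInfty →⋆ₙₐ[ℂ] FreeProduct A' FInfty :=
  FreeProduct.lift (FreeProduct.inl.comp γ) (FInfty.lift (connectingSeq A') norm_connectingSeq_le)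

theorem connectingHom_comp_inl (γ : A →⋆ₙₐ[ℂ] A') :
    (connectingHom γ).comp FreeProduct.inl = FreeProduct.inl.comp γ :=
  FreeProduct.lift_comp_inl _ _

theorem connectingHom_inr_gen (γ : A →⋆ₙₐ[ℂ] A') (n : ℕ) :
    connectingHom γ (FreeProduct.inr (FInfty.gen n)) = connectingSeq A' n := by
  rw [connectingHom, ← NonUnitalStarAlgHom.comp_apply, FreeProduct.lift_comp_inr, FInfty.lift_gen]

/-- The range is a closed `*`-subalgebra, so it is enough to hit generators of each factor: even
indices supply those of `A'`, odd indices those of `FInfty`. -/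
theorem connectingHom_surjective (γ : A →⋆ₙₐ[ℂ] A') :
    Function.Surjective (connectingHom γ) := by
  let S := NonUnitalStarAlgHom.range (connectingHom γ)
  have hS : IsClosed (S : Set (FreeProduct A' FInfty)) :=
    isClosed_range_starAlgHom (connectingHom γ)
  refine FreeProduct.mem_of_isClosed S hS ?_ ?_
  · refine mem_of_contractionSeq_mem (S.comap FreeProduct.inl)
      (hS.preimage (continuous_starAlgHom FreeProduct.inl)) fun n => ?_
    exact ⟨FreeProduct.inr (FInfty.gen (2 * n)),
      (connectingHom_inr_gen γ _).trans (connectingSeq_two_mul n)⟩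
  · refine UniversalCStar.mem_of_isClosed (S.comap FreeProduct.inr)
      (hS.preimage (continuous_starAlgHom FreeProduct.inr)) fun n => ?_
    exact ⟨FreeProduct.inr (FInfty.gen (2 * n + 1)),
      (connectingHom_inr_gen γ _).trans (connectingSeq_two_mul_add_one n)⟩

end Connecting

/-! ### Comparison of the two inductive limits -/

section Limit

variable {A : ℕ → Type u} [∀ k, NonUnitalCStarAlgebra (A k)]
  [∀ k, TopologicalSpace.SeparableSpace (A k)] (γ : ∀ k, A k →⋆ₙₐ[ℂ] A (k + 1))

/-- The element of the inductive limit that the `n`-th generator of `FInfty` in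
`FreeProduct (A k) FInfty` is eventually mapped to. -/
def limitGen (n k : ℕ) : InductiveLimit γ :=
  if h : Even n then InductiveLimit.incl γ (k + 1) (contractionSeq (A (k + 1)) (n / 2))
  else limitGen (n / 2) (k + 1)
termination_by n
decreasing_by
  -- The index `0` would be a fixed point of halving; it is even, so the recursion never halves it.
  have : n ≠ 0 := fun h0 => h (h0 ▸ Even.zero)
  omega

theorem limitGen_two_mul (n k : ℕ) : limitGen γ (2 * n) k =
    InductiveLimit.incl γ (k + 1) (contractionSeq (A (k + 1)) n) := by
  rw [limitGen]
  simp

theorem limitGen_two_mul_add_one (n k : ℕ) :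
    limitGen γ (2 * n + 1) k = limitGen γ n (k + 1) := by
  have : (2 * n + 1) / 2 = n := by omega
  rw [limitGen]
  simp [this]

theorem norm_limitGen_le (n : ℕ) : ∀ k, ‖limitGen γ n k‖ ≤ 1 := by
  induction n using Nat.strong_induction_on with
  | _ n ih =>
    intro k
    obtain ⟨m, rfl | rfl⟩ := n.even_or_odd'
    · rw [limitGen_two_mul]
      exact (NonUnitalStarAlgHom.norm_apply_le _ _).trans (norm_contractionSeq_le _ _)
    · rw [limitGen_two_mul_add_one]
      exact ih m (by omega) _

/-- The morphism from `FreeProduct (A k) FInfty` to the inductive limit of the `A k`. -/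
def toLimit (k : ℕ) : FreeProduct (A k) FInfty →⋆ₙₐ[ℂ] InductiveLimit γ :=
  FreeProduct.lift (InductiveLimit.incl γ k)
    (FInfty.lift (fun n => limitGen γ n k) fun n => norm_limitGen_le γ n k)

theorem toLimit_comp_inl (k : ℕ) :
    (toLimit γ k).comp FreeProduct.inl = InductiveLimit.incl γ k :=
  FreeProduct.lift_comp_inl _ _

theorem toLimit_inr_gen (k n : ℕ) :
    toLimit γ k (FreeProduct.inr (FInfty.gen n)) = limitGen γ n k := by
  rw [toLimit, ← NonUnitalStarAlgHom.comp_apply, FreeProduct.lift_comp_inr, FInfty.lift_gen]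

/-- On the generators of `FInfty` this holds because the recursion for `limitGen` follows
`connectingSeq` case by case. -/
theorem toLimit_comp_connectingHom (k : ℕ) :
    (toLimit γ (k + 1)).comp (connectingHom (γ k)) = toLimit γ k := by
  refine FreeProduct.hom_ext ?_ (FInfty.hom_ext fun n => ?_)
  · rw [NonUnitalStarAlgHom.comp_assoc, connectingHom_comp_inl, ← NonUnitalStarAlgHom.comp_assoc,
      toLimit_comp_inl, InductiveLimit.incl_comp, toLimit_comp_inl]
  · simp only [NonUnitalStarAlgHom.comp_apply]
    rw [connectingHom_inr_gen, toLimit_inr_gen]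
    obtain ⟨m, rfl | rfl⟩ := n.even_or_odd'
    · rw [connectingSeq_two_mul, limitGen_two_mul]
      exact DFunLike.congr_fun (toLimit_comp_inl γ (k + 1)) _
    · rw [connectingSeq_two_mul_add_one, limitGen_two_mul_add_one, toLimit_inr_gen]

/-- The inductive limit of the surjective system. -/
abbrev ConnectingLimit : Type u :=
  InductiveLimit (A := fun k => FreeProduct (A k) FInfty) fun k => connectingHom (γ k)

/-- The canonical morphism into the inductive limit of the surjective system. -/
def connectingIncl (k : ℕ) : FreeProduct (A k) FInfty →⋆ₙₐ[ℂ] ConnectingLimit γ :=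
  InductiveLimit.incl (A := fun k => FreeProduct (A k) FInfty) (fun k => connectingHom (γ k)) k

theorem connectingIncl_comp (k : ℕ) :
    (connectingIncl γ (k + 1)).comp (connectingHom (γ k)) = connectingIncl γ k :=
  InductiveLimit.incl_comp (A := fun k => FreeProduct (A k) FInfty)
    (fun k => connectingHom (γ k)) k

/-- The morphism from the limit of the `A k` to the limit of the surjective system. -/
def limitHom : InductiveLimit γ →⋆ₙₐ[ℂ] ConnectingLimit γ :=
  InductiveLimit.lift (fun k => (connectingIncl γ k).comp FreeProduct.inl) fun k => by
    rw [NonUnitalStarAlgHom.comp_assoc, ← connectingHom_comp_inl,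
      ← NonUnitalStarAlgHom.comp_assoc, connectingIncl_comp]

theorem limitHom_comp_incl (k : ℕ) : (limitHom γ).comp (InductiveLimit.incl γ k) =
    (connectingIncl γ k).comp FreeProduct.inl :=
  InductiveLimit.lift_comp_incl _ _ k

/-- The morphism from the limit of the surjective system to the limit of the `A k`. -/
def limitInv : ConnectingLimit γ →⋆ₙₐ[ℂ] InductiveLimit γ :=
  InductiveLimit.lift (A := fun k => FreeProduct (A k) FInfty) (toLimit γ)
    (toLimit_comp_connectingHom γ)

theorem limitInv_comp_incl (k : ℕ) : (limitInv γ).comp (connectingIncl γ k) = toLimit γ k :=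
  InductiveLimit.lift_comp_incl (A := fun k => FreeProduct (A k) FInfty) _ _ k

/-- This is where the extra generators are seen to add nothing to the limit: each already comes from
some `A j`. The induction is on `n` with `k` free, since an odd step lowers the index but raises the
stage. -/
theorem limitHom_limitGen (n : ℕ) : ∀ k, limitHom γ (limitGen γ n k) =
    connectingIncl γ k (FreeProduct.inr (FInfty.gen n)) := by
  induction n using Nat.strong_induction_on with
  | _ n ih =>
    intro k
    -- The generator is pushed one stage forward, where it is either in the first factor or a
    -- generator of smaller index.
    rw [← connectingIncl_comp, NonUnitalStarAlgHom.comp_apply, connectingHom_inr_gen]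
    obtain ⟨m, rfl | rfl⟩ := n.even_or_odd'
    · rw [limitGen_two_mul, connectingSeq_two_mul]
      exact DFunLike.congr_fun (limitHom_comp_incl γ (k + 1)) _
    · rw [limitGen_two_mul_add_one, connectingSeq_two_mul_add_one, ih m (by omega)]

theorem limitHom_comp_toLimit (k : ℕ) :
    (limitHom γ).comp (toLimit γ k) = connectingIncl γ k := by
  refine FreeProduct.hom_ext ?_ (FInfty.hom_ext fun n => ?_)
  · rw [NonUnitalStarAlgHom.comp_assoc, toLimit_comp_inl, limitHom_comp_incl]
  · simp only [NonUnitalStarAlgHom.comp_apply]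
    rw [toLimit_inr_gen, limitHom_limitGen]

/-- The inductive limit is not changed by passing to the surjective system. -/
def limitEquiv : InductiveLimit γ ≃⋆ₐ[ℂ] ConnectingLimit γ :=
  StarAlgEquiv.ofNonUnitalStarAlgHom (limitHom γ) (limitInv γ)
    -- This composite is tested on the `A k` alone, where `toLimit` is the canonical inclusion; the
    -- other composite needs the absorption of the generators.
    (InductiveLimit.hom_ext fun k => by
      rw [NonUnitalStarAlgHom.comp_assoc, limitHom_comp_incl, ← NonUnitalStarAlgHom.comp_assoc,
        limitInv_comp_incl, toLimit_comp_inl, NonUnitalStarAlgHom.id_comp])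
    (InductiveLimit.hom_ext (A := fun k => FreeProduct (A k) FInfty) fun k => by
      change ((limitHom γ).comp (limitInv γ)).comp (connectingIncl γ k) = connectingIncl γ k
      rw [NonUnitalStarAlgHom.comp_assoc, limitInv_comp_incl, limitHom_comp_toLimit])

end Limit

end

theorem mainTheorem9 {A : ℕ → Type u} [∀ k, NonUnitalCStarAlgebra (A k)]
    [∀ k, TopologicalSpace.SeparableSpace (A k)] (γ : ∀ k, A k →⋆ₙₐ[ℂ] A (k + 1)) :
    (∃ δ : ∀ k, FreeProduct (A k) FInfty →⋆ₙₐ[ℂ] FreeProduct (A (k + 1)) FInfty,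
      (∀ k, Function.Surjective (δ k)) ∧
      Nonempty (InductiveLimit γ ≃⋆ₐ[ℂ]
        InductiveLimit (A := fun k => FreeProduct (A k) FInfty) δ)) ∧
    (∀ k, IsProjectiveCStar (A k) → IsProjectiveCStar (FreeProduct (A k) FInfty)) ∧
    (∀ k, IsSemiprojectiveCStar (A k) → IsSemiprojectiveCStar (FreeProduct (A k) FInfty)) :=
  ⟨⟨fun k => connectingHom (γ k), fun k => connectingHom_surjective (γ k), ⟨limitEquiv γ⟩⟩,
    fun _ h => h.freeProduct_fInfty, fun _ h => h.freeProduct_fInfty⟩
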